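/- Let $X$ be an alphabet and let $u,v\in X^+$ be nonempty positive words such that $\langle X\mid u=v\rangle$ is an Adian presentation: neither the left graph nor the right graph has a cycle, where the left (right) graph is the undirected multigraph with vertex set $X$ and one edge for each relation, joining the first (last) letters of its two sides; a loop counts as a cycle. Suppose that neither of $u,v$ is a subword (factor) of the other, and that there are no overlaps: for $r,s\in\{u,v\}$ (including $r=s$), no nonempty proper suffix of $r$ is a proper prefix of $s$. Let $M=\mathrm{Inv}\langle X\mid u=v\rangle$ be the inverse monoid with this presentation, i.e. the quotient of $(X\cup X^{-1})^*$ by the congruence generated by the Vagner congruence and $(u,v)$. For a word $w$ over $X\cup X^{-1}$ let $S\Gamma(w)$ be its Schützenberger graph, i.e. the strongly connected component of $w$ in the Cayley graph of $M$ (which has an edge labeled $a\in X\cup X^{-1}$ from $m$ to $ma$ for every $m\in M$). Then for every positive word $t\in X^+$ the graph $S\Gamma(t)$ is finite. Moreover it is obtained from the linear graph of $t$ by a single full $\mathscr P$-expansion: perform simultaneously all elementary $\mathscr P$-expansions possible in the linear graph of $t$ (whenever $\{r,s\}=\{u,v\}$ and $r$, but not $s$, labels a path from a vertex $p$ to a vertex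 $q$, sew on a new path labeled $s$ from $p$ to $q$, with its inverse edges), and then perform all foldings (identify edges with the same label and the same initial vertex, until this is no longer possible). The resulting birooted graph is isomorphic, as a birooted labeled graph, to the Schützenberger automaton $(tt^{-1},S\Gamma(t),t)$. -/

import Mathlib

universe u v w

namespace AdianInv

/-! ## Positive presentations, the left and right graphs, cycle-freeness

A set of relations is a set `R : Set (List X × List X)` of pairs of words over the alphabet `X`. -/

/-- The undirected multigraph on the alphabet `X` with one edge for every relation `(r, s) ∈ R`,
joining the letters picked out of `r` and of `s` by `f`. -/
def letterGraph {X : Type u} (f : List X → Option X) (R : Set (List X × List X)) :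
    Graph X (List X × List X) where
  vertexSet := Set.univ
  IsLink e x y := e ∈ R ∧ ((f e.1 = some x ∧ f e.2 = some y) ∨ (f e.1 = some y ∧ f e.2 = some x))
  isLink_symm := fun _ _ => ⟨fun _ _ h => ⟨h.1, h.2.symm⟩⟩
  eq_or_eq_of_isLink_of_isLink := by
    rintro e x y v w ⟨-, h⟩ ⟨-, h'⟩
    rcases h with ⟨h1, h2⟩ | ⟨h1, h2⟩ <;> rcases h' with ⟨h3, h4⟩ | ⟨h3, h4⟩ <;> simp_all
  left_mem_of_isLink := fun _ _ _ _ => Set.mem_univ _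

/-- The left graph: every relation joins the first letters of its two sides. -/
def leftGraph {X : Type u} (R : Set (List X × List X)) : Graph X (List X × List X) :=
  letterGraph List.head? R

/-- The right graph: every relation joins the last letters of its two sides. -/
def rightGraph {X : Type u} (R : Set (List X × List X)) : Graph X (List X × List X) :=
  letterGraph List.getLast? R

/-- `IsWalk G x es y`: the list of edges `es` can be traversed consecutively from `x` to `y`. -/
def IsWalk {V : Type u} {E : Type v} (G : Graph V E) : V → List E → V → Prop
  | x, [], y => x = y
  | x, e :: es, y => ∃ z, G.IsLink e x z ∧ IsWalk G z es y

/-- A multigraph is cycle free if it has no closed path of positive length without repeated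
edges. (A loop is such a closed path, and so is a pair of parallel edges.) -/
def CycleFree {V : Type u} {E : Type v} (G : Graph V E) : Prop :=
  ∀ (x : V) (es : List E), IsWalk G x es x → es.Nodup → es = []

/-- An Adian presentation: all relations are pairs of nonempty positive words, and neither the left
nor the right graph has a cycle. -/
structure IsAdian {X : Type u} (R : Set (List X × List X)) : Prop where
  positive : ∀ r ∈ R, r.1 ≠ [] ∧ r.2 ≠ []
  left_cycleFree : CycleFree (leftGraph R)
  right_cycleFree : CycleFree (rightGraph R)

/-- A word `r` overlaps a word `s`: some nonempty word `z` is a proper suffix of `r` and a proper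
prefix of `s`. The case `r = s` says that `r` overlaps itself. -/
def Overlaps {X : Type u} (r s : List X) : Prop :=
  ∃ p z q : List X, p ≠ [] ∧ z ≠ [] ∧ q ≠ [] ∧ r = p ++ z ∧ s = z ++ q

/-! ## The inverse monoid `Inv⟨X|R⟩`

The pair `(x, true)` stands for the letter `x` and `(x, false)` for its formal inverse. -/

/-- The formal inverse of a letter of `X ∪ X⁻¹`. -/
def invLetter {X : Type u} (a : X × Bool) : X × Bool := (a.1, !a.2)

/-- The formal inverse of a word over `X ∪ X⁻¹`. -/
def invWord {X : Type u} (w : List (X × Bool)) : List (X × Bool) := (w.map invLetter).reverse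

/-- A positive word, as a word over `X ∪ X⁻¹`. -/
def pos {X : Type u} (w : List X) : List (X × Bool) := w.map fun x => (x, true)

/-- The generating pairs of the congruence `τ`: those of the Vagner congruence, and the
relations of `R`. -/
inductive InvRel {X : Type u} (R : Set (List X × List X)) :
    FreeMonoid (X × Bool) → FreeMonoid (X × Bool) → Prop
  | regular (w : List (X × Bool)) :
      InvRel R (FreeMonoid.ofList (w ++ invWord w ++ w)) (FreeMonoid.ofList w)
  | comm (w z : List (X × Bool)) :
      InvRel R (FreeMonoid.ofList (w ++ invWord w ++ (z ++ invWord z)))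
        (FreeMonoid.ofList (z ++ invWord z ++ (w ++ invWord w)))
  | rel (r s : List X) (h : (r, s) ∈ R) :
      InvRel R (FreeMonoid.ofList (pos r)) (FreeMonoid.ofList (pos s))

/-- The inverse monoid `Inv⟨X|R⟩`, the quotient of the free monoid on `X ∪ X⁻¹` by the congruence
generated by the Vagner congruence and `R`. -/
abbrev InvMonoid {X : Type u} (R : Set (List X × List X)) : Type u := (conGen (InvRel R)).Quotient

/-- The element of `Inv⟨X|R⟩` represented by a word over `X ∪ X⁻¹`. -/
def val {X : Type u} (R : Set (List X × List X)) (w : List (X × Bool)) : InvMonoid R :=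
  (conGen (InvRel R)).mk' (FreeMonoid.ofList w)

/-! ## Labeled directed graphs -/

/-- A directed graph whose edges are labeled by elements of `A`; `G.Edge p a q` says that
`(p, a, q)` is an edge. -/
structure LGraph (A : Type u) where
  V : Type v
  Edge : V → A → V → Prop

/-- `G.Reads p w q`: the word `w` labels a path from `p` to `q`. -/
def LGraph.Reads {A : Type u} (G : LGraph.{u, v} A) : G.V → List A → G.V → Prop
  | p, [], q => p = q
  | p, a :: w, q => ∃ z, G.Edge p a z ∧ G.Reads z w q

/-- A labeled graph is finite if it has finitely many vertices and finitely many edges. -/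
def LGraph.IsFinite {A : Type u} (G : LGraph.{u, v} A) : Prop :=
  Finite G.V ∧ {e : G.V × A × G.V | G.Edge e.1 e.2.1 e.2.2}.Finite

/-- The quotient of a labeled graph obtained by identifying vertices related by `r` (and edges that
then have the same ends and the same label). -/
def LGraph.quot {A : Type u} (G : LGraph.{u, v} A) (r : G.V → G.V → Prop) : LGraph.{u, v} A where
  V := Quot r
  Edge p a q := ∃ p' q', Quot.mk r p' = p ∧ Quot.mk r q' = q ∧ G.Edge p' a q'

/-- The strongly connected component of the vertex `m`, as a labeled graph. -/
def LGraph.component {A : Type u} (G : LGraph.{u, v} A) (m : G.V) : LGraph.{u, v} A where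
  V := {n : G.V // (∃ w, G.Reads m w n) ∧ (∃ w, G.Reads n w m)}
  Edge p a q := G.Edge p.1 a q.1

/-- A birooted labeled graph: a labeled graph with a start and an end vertex. -/
structure Birooted (A : Type u) extends LGraph.{u, v} A where
  start : V
  final : V

/-- Isomorphisms of birooted labeled graphs. -/
structure Birooted.Iso {A : Type u} (G : Birooted.{u, v} A) (H : Birooted.{u, w} A) where
  toEquiv : G.V ≃ H.V
  edge_iff : ∀ p a q, H.Edge (toEquiv p) a (toEquiv q) ↔ G.Edge p a q
  map_start : toEquiv G.start = H.start
  map_final : toEquiv G.final = H.final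

/-- The quotient of a birooted labeled graph by the identification of vertices related by `r`. -/
def Birooted.quot {A : Type u} (G : Birooted.{u, v} A) (r : G.V → G.V → Prop) :
    Birooted.{u, v} A where
  toLGraph := G.toLGraph.quot r
  start := Quot.mk r G.start
  final := Quot.mk r G.final

/-! ## Schützenberger graphs -/

/-- The Cayley graph of `Inv⟨X|R⟩`: an edge labeled `a ∈ X ∪ X⁻¹` from `m` to `m * a`. -/
def cayley {X : Type u} (R : Set (List X × List X)) : LGraph.{u, u} (X × Bool) where
  V := InvMonoid R
  Edge m a n := n = m * val R [a]

/-- The Schützenberger graph `SΓ(t)`: the strongly connected component of the Cayley graph that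
contains the vertex represented by `t`. -/
def schutzenbergerGraph {X : Type u} (R : Set (List X × List X)) (t : List (X × Bool)) :
    LGraph.{u, u} (X × Bool) :=
  (cayley R).component (val R t)

theorem val_append {X : Type u} (R : Set (List X × List X)) (w z : List (X × Bool)) :
    val R (w ++ z) = val R w * val R z := by
  simp [val, FreeMonoid.ofList_append]

theorem cayley_reads {X : Type u} (R : Set (List X × List X)) (m : InvMonoid R)
    (w : List (X × Bool)) : (cayley R).Reads m w (m * val R w) := by
  induction w generalizing m with
  | nil => exact (mul_one m).symm
  | cons a w ih =>
    refine ⟨m * val R [a], rfl, ?_⟩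
    have h := ih (m * val R [a])
    rwa [mul_assoc, ← val_append] at h

theorem val_regular {X : Type u} (R : Set (List X × List X)) (w : List (X × Bool)) :
    val R (w ++ invWord w) * val R w = val R w := by
  rw [← val_append]
  exact (Con.eq _).2 (ConGen.Rel.of _ _ (InvRel.regular w))

/-- The Schützenberger automaton `(tt⁻¹, SΓ(t), t)`. -/
def schutzenbergerAutomaton {X : Type u} (R : Set (List X × List X)) (t : List (X × Bool)) :
    Birooted.{u, u} (X × Bool) where
  toLGraph := schutzenbergerGraph R t
  start := ⟨val R (t ++ invWord t),
    ⟨invWord t, by rw [val_append]; exact cayley_reads R _ _⟩,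
    ⟨t, by
      have h := cayley_reads R (val R (t ++ invWord t)) t
      rwa [val_regular] at h⟩⟩
  final := ⟨val R t, ⟨[], rfl⟩, ⟨[], rfl⟩⟩

/-! ## Stephen's construction -/

/-- The linear graph of a word `w = a₁ ⋯ aₙ` over `X ∪ X⁻¹`: vertices `0, …, n`, an edge labeled
`aᵢ₊₁` from `i` to `i + 1`, and the inverses of these edges. -/
def linear {X : Type u} (w : List (X × Bool)) : Birooted.{u, 0} (X × Bool) where
  V := Fin (w.length + 1)
  Edge i a j := (j.val = i.val + 1 ∧ w[i.val]? = some a) ∨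
    (i.val = j.val + 1 ∧ w[j.val]? = some (invLetter a))
  start := 0
  final := Fin.last _

/-- The places at which an elementary `𝒫`-expansion of `G` can be performed: a relation `r = s` of
`R` (read in either direction) and vertices `p`, `q` such that `r` can be read from `p` to `q` in
`G`, but `s` cannot. -/
structure Site {X : Type u} (R : Set (List X × List X)) (G : Birooted.{u, v} (X × Bool)) where
  r : List X
  s : List X
  p : G.V
  q : G.V
  mem : (r, s) ∈ R ∨ (s, r) ∈ R
  reads : G.Reads p (pos r) q
  not_reads : ¬ G.Reads p (pos s) q

/-- The disjoint union of `G` and one linear graph of `s` for every site `(r, s, p, q)` of `G`. -/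
def disjointUnion {X : Type u} (R : Set (List X × List X)) (G : Birooted.{u, v} (X × Bool)) :
    Birooted.{u, max u v} (X × Bool) where
  V := G.V ⊕ (Σ σ : Site R G, (linear (pos σ.s)).V)
  Edge
    | .inl p, a, .inl q => G.Edge p a q
    | .inr x, a, .inr y => ∃ (σ : Site R G) (i j : (linear (pos σ.s)).V),
        x = ⟨σ, i⟩ ∧ y = ⟨σ, j⟩ ∧ (linear (pos σ.s)).Edge i a j
    | _, _, _ => False
  start := .inl G.start
  final := .inl G.final

/-- The identifications that sew the linear graph of `s` onto `G` from `p` to `q`, at every site. -/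
inductive Sew {X : Type u} (R : Set (List X × List X)) (G : Birooted.{u, v} (X × Bool)) :
    (disjointUnion R G).V → (disjointUnion R G).V → Prop
  | start (σ : Site R G) : Sew R G (.inl σ.p) (.inr ⟨σ, (linear (pos σ.s)).start⟩)
  | final (σ : Site R G) : Sew R G (.inl σ.q) (.inr ⟨σ, (linear (pos σ.s)).final⟩)

/-- The result of performing all the elementary `𝒫`-expansions possible in `G`, simultaneously. -/
def expandAll {X : Type u} (R : Set (List X × List X)) (G : Birooted.{u, v} (X × Bool)) :
    Birooted.{u, max u v} (X × Bool) :=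
  (disjointUnion R G).quot (Sew R G)

/-- The identifications of vertices forced by (iterated) folding: the least equivalence relation
such that edges with the same label that start at related vertices end at related vertices. -/
inductive Fold {A : Type u} (G : LGraph.{u, v} A) : G.V → G.V → Prop
  | refl (p : G.V) : Fold G p p
  | symm {p q : G.V} : Fold G p q → Fold G q p
  | trans {p q r : G.V} : Fold G p q → Fold G q r → Fold G p r
  | fold {p p' q q' : G.V} {a : A} : Fold G p p' → G.Edge p a q → G.Edge p' a q' → Fold G q q'

/-- The determinized form of a graph: the result of performing all foldings. -/
def determinize {A : Type u} (G : Birooted.{u, v} A) : Birooted.{u, v} A :=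
  G.quot (Fold G.toLGraph)

/-- The full `𝒫`-expansion of a birooted graph. -/
def fullExpansion {X : Type u} (R : Set (List X × List X)) (G : Birooted.{u, v} (X × Bool)) :
    Birooted.{u, max u v} (X × Bool) :=
  determinize (expandAll R G)

end AdianInv

namespace AdianInv

/-! ## Paths in labeled graphs -/

section Paths

variable {A : Type u} {X : Type u}

/-! The proof has two halves: a criterion recognizing Schützenberger automata, and the verification
that one expansion already satisfies it.

Criterion (`nonempty_iso_schutzenbergerAutomaton`). On an inverse graph in which the two sides of
every relation label the same paths, words with equal value in the inverse monoid label the same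
paths (`reads_iff_of_val_eq`). If moreover everything is reachable from the start, `t` is read from
start to end, and a map `φ` to the monoid is compatible with edges and sends the start to `tt⁻¹`,
then `φ` is an isomorphism onto the Schützenberger automaton.

For the full expansion of the linear graph of `t`, folding gives determinism and sewing preserves
reachability. The map `φ` is defined on the pieces before gluing and descends by the universal
property `exists_lift_fullExpansion`. What remains is closure under the relation: no second
expansion must be possible.

Closure is read off an explicit graph `model`. Cycle-freeness forbids loops, so `u` and `v` differ
in their first and in their last letters; without factors, at most one side occurs at a given
position of `t`, or ends there. Hence the model is already deterministic, and the expansion embeds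
in it. A path in the model labeled by a side `r` either runs along `t`, where the other side was
sewn on, or is a whole sewn path, parallel to an occurrence of the other side. Any other course
would produce a forbidden factor or overlap (`IsRigid.model_closed`). -/

theorem LGraph.reads_append (G : LGraph.{u, v} A) (w z : List A) (p q : G.V) :
    G.Reads p (w ++ z) q ↔ ∃ m, G.Reads p w m ∧ G.Reads m z q := by
  induction w generalizing p with
  | nil => simp [LGraph.Reads]
  | cons a w ih =>
    simp only [List.cons_append, LGraph.Reads, ih]
    constructor
    · rintro ⟨x, h, m, h1, h2⟩; exact ⟨m, ⟨x, h, h1⟩, h2⟩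
    · rintro ⟨m, ⟨x, h, h1⟩, h2⟩; exact ⟨x, h, m, h1, h2⟩

theorem LGraph.Reads.map {G : LGraph.{u, v} A} {H : LGraph.{u, w} A} (f : G.V → H.V)
    (hf : ∀ p a q, G.Edge p a q → H.Edge (f p) a (f q)) {p q : G.V} {z : List A}
    (h : G.Reads p z q) : H.Reads (f p) z (f q) := by
  induction z generalizing p with
  | nil => exact congrArg f h
  | cons a z ih => obtain ⟨x, h1, h2⟩ := h; exact ⟨f x, hf _ _ _ h1, ih h2⟩

/-- Inverse graphs: deterministic, with an inverse for every edge. -/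
structure LGraph.IsInverse (G : LGraph.{u, v} (X × Bool)) : Prop where
  symm : ∀ {p a q}, G.Edge p a q → G.Edge q (invLetter a) p
  det : ∀ {p a q q'}, G.Edge p a q → G.Edge p a q' → q = q'

theorem invLetter_invLetter (a : X × Bool) : invLetter (invLetter a) = a := by
  simp [invLetter]

theorem invWord_cons (a : X × Bool) (w : List (X × Bool)) :
    invWord (a :: w) = invWord w ++ [invLetter a] := by
  simp [invWord]

theorem invWord_append (w z : List (X × Bool)) :
    invWord (w ++ z) = invWord z ++ invWord w := by
  simp [invWord]

theorem invWord_invWord (w : List (X × Bool)) : invWord (invWord w) = w := by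
  have : (invLetter ∘ invLetter : X × Bool → X × Bool) = id := funext invLetter_invLetter
  simp [invWord, this]

theorem pos_append (r s : List X) : pos (r ++ s) = pos r ++ pos s := List.map_append

theorem LGraph.Reads.inv {G : LGraph.{u, v} (X × Bool)}
    (hG : ∀ {p a q}, G.Edge p a q → G.Edge q (invLetter a) p) {p q : G.V} {w : List (X × Bool)}
    (h : G.Reads p w q) : G.Reads q (invWord w) p := by
  induction w generalizing p with
  | nil => exact Eq.symm h
  | cons a w ih =>
    obtain ⟨x, h1, h2⟩ := h
    rw [invWord_cons, LGraph.reads_append]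
    exact ⟨x, ih h2, p, hG h1, rfl⟩

namespace LGraph.IsInverse

variable {G : LGraph.{u, v} (X × Bool)}

theorem reads_det (hG : G.IsInverse) {p q q' : G.V} {w : List (X × Bool)}
    (h : G.Reads p w q) (h' : G.Reads p w q') : q = q' := by
  induction w generalizing p with
  | nil => exact Eq.trans (Eq.symm h) h'
  | cons a w ih =>
    obtain ⟨x, h1, h2⟩ := h
    obtain ⟨y, h3, h4⟩ := h'
    obtain rfl := hG.det h1 h3
    exact ih h2 h4

theorem reads_symm (hG : G.IsInverse) {p q : G.V} {w : List (X × Bool)}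
    (h : G.Reads p w q) : G.Reads q (invWord w) p := h.inv hG.symm

theorem reads_append_invWord (hG : G.IsInverse) {p q : G.V} {w : List (X × Bool)} :
    G.Reads p (w ++ invWord w) q ↔ p = q ∧ ∃ x, G.Reads p w x := by
  rw [LGraph.reads_append]
  constructor
  · rintro ⟨m, h1, h2⟩
    exact ⟨hG.reads_det (hG.reads_symm h1) h2, m, h1⟩
  · rintro ⟨rfl, m, h⟩
    exact ⟨m, h, hG.reads_symm h⟩

/-- `Inv⟨X|R⟩` acts by partial bijections on every inverse graph in which the two sides of each
relation label the same paths. -/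
theorem reads_iff_of_val_eq (hG : G.IsInverse) {R : Set (List X × List X)}
    (hR : ∀ r s, (r, s) ∈ R → ∀ p q, G.Reads p (pos r) q ↔ G.Reads p (pos s) q)
    {w z : List (X × Bool)} (h : val R w = val R z) (p q : G.V) :
    G.Reads p w q ↔ G.Reads p z q := by
  -- Labeling the same paths is a congruence on words, so only the generating pairs have to be
  -- checked.
  let c : Con (FreeMonoid (X × Bool)) :=
    { r := fun w z => ∀ p q, G.Reads p w.toList q ↔ G.Reads p z.toList q
      iseqv := ⟨fun _ _ _ => Iff.rfl, fun h p q => (h p q).symm,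
        fun h h' p q => (h p q).trans (h' p q)⟩
      mul' := by
        intro a b c d h h' p q
        rw [FreeMonoid.toList_mul, FreeMonoid.toList_mul, LGraph.reads_append,
          LGraph.reads_append]
        simp only [h, h'] }
  have hle : conGen (InvRel R) ≤ c := by
    rw [Con.conGen_le]
    intro a b hab
    cases hab with
    | regular w =>
      intro p q
      simp only [FreeMonoid.toList_ofList]
      rw [LGraph.reads_append]
      simp only [hG.reads_append_invWord]
      constructor
      · rintro ⟨m, ⟨rfl, -⟩, h⟩; exact h
      · intro h; exact ⟨p, ⟨rfl, q, h⟩, h⟩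
    | comm w z =>
      intro p q
      simp only [FreeMonoid.toList_ofList]
      rw [LGraph.reads_append, LGraph.reads_append]
      simp only [hG.reads_append_invWord]
      constructor
      · rintro ⟨m, ⟨rfl, h⟩, rfl, h'⟩; exact ⟨p, ⟨rfl, h'⟩, rfl, h⟩
      · rintro ⟨m, ⟨rfl, h⟩, rfl, h'⟩; exact ⟨p, ⟨rfl, h'⟩, rfl, h⟩
    | rel r s h =>
      intro p q
      exact hR r s h p q
  exact hle ((Con.eq _).1 h) p q

end LGraph.IsInverse

end Paths

/-! ## The inverse monoid -/

section Monoid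

variable {X : Type u} (R : Set (List X × List X))

theorem exists_val_eq (m : InvMonoid R) : ∃ w, val R w = m := by
  obtain ⟨w, rfl⟩ := Con.mk'_surjective m
  exact ⟨w.toList, rfl⟩

theorem val_rel {r s : List X} (h : (r, s) ∈ R) : val R (pos r) = val R (pos s) :=
  (Con.eq _).2 (ConGen.Rel.of _ _ (InvRel.rel r s h))

theorem val_mul_inv_mul (w : List (X × Bool)) :
    val R w * val R (invWord w) * val R w = val R w := by
  rw [← val_append, val_regular]

theorem val_inv_mul_inv (w : List (X × Bool)) :
    val R (invWord w) * val R w * val R (invWord w) = val R (invWord w) := by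
  simpa only [invWord_invWord] using val_mul_inv_mul R (invWord w)

theorem val_idem_comm (w z : List (X × Bool)) :
    val R w * val R (invWord w) * (val R z * val R (invWord z)) =
      val R z * val R (invWord z) * (val R w * val R (invWord w)) := by
  simp only [← val_append]
  exact (Con.eq _).2 (ConGen.Rel.of _ _ (InvRel.comm w z))

variable {R}

/-- Inverses are unique as soon as the idempotents `ww⁻¹` commute, so formal inversion is well
defined on values. -/
theorem val_invWord_congr {w z : List (X × Bool)} (h : val R w = val R z) :
    val R (invWord w) = val R (invWord z) := by
  have hb := val_inv_mul_inv R w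
  have hc := val_inv_mul_inv R z
  have ha := val_mul_inv_mul R w
  have ha' := val_mul_inv_mul R z
  have h1 := val_idem_comm R w z
  have h2 := val_idem_comm R (invWord w) (invWord z)
  simp only [invWord_invWord] at h2
  rw [← h] at hc ha' h1 h2
  generalize val R w = a at *
  generalize val R (invWord w) = b at *
  generalize val R (invWord z) = c at *
  calc b = b * (a * c * a) * b := by rw [ha', hb]
    _ = b * (a * c * (a * b)) := by simp only [mul_assoc]
    _ = b * a * b * (a * c) := by rw [← h1]; simp only [mul_assoc]
    _ = b * a * (c * a * c) := by rw [hb, hc, mul_assoc]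
    _ = c * (a * b * a) * c := by
      calc b * a * (c * a * c) = b * a * (c * a) * c := by simp only [mul_assoc]
        _ = c * (a * b * a) * c := by rw [h2]; simp only [mul_assoc]
    _ = c := by rw [ha, hc]

/-- Inside a strongly connected component of the Cayley graph every edge has an inverse edge. If `y
= az` fixes `m`, then `m` is fixed by `yy⁻¹`, which lies below `aa⁻¹`. -/
theorem mul_val_invLetter {m : InvMonoid R} {a : X × Bool} {n : InvMonoid R}
    (h : m * val R [a] * n = m) : m * val R [a] * val R [invLetter a] = m := by
  obtain ⟨w, rfl⟩ := exists_val_eq R m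
  obtain ⟨z, rfl⟩ := exists_val_eq R n
  have h1 : val R (w ++ ([a] ++ z)) = val R w := by
    rw [val_append, val_append, ← mul_assoc, h]
  have h2 := val_invWord_congr h1
  set y := [a] ++ z
  have h3 : val R w = val R w * (val R y * val R (invWord y)) := by
    calc val R w = val R (w ++ y) * val R (invWord (w ++ y)) * val R w := by
          rw [h1, h2, val_mul_inv_mul]
      _ = val R w * ((val R y * val R (invWord y)) * (val R (invWord w) * val R w)) := by
          simp only [invWord_append, val_append, mul_assoc]
      _ = val R w * val R (invWord w) * val R w * (val R y * val R (invWord y)) := by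
          have := val_idem_comm R (invWord w) y
          rw [invWord_invWord] at this
          rw [← this]; simp only [mul_assoc]
      _ = _ := by rw [val_mul_inv_mul]
  -- `yy⁻¹` absorbs `aa⁻¹` because `y` begins with `a`.
  have h4 : val R y * val R (invWord y) * (val R [a] * val R [invLetter a]) =
      val R y * val R (invWord y) := by
    have := val_idem_comm R [a] y
    rw [show invWord [a] = [invLetter a] from rfl] at this
    rw [← this]
    have h5 := val_mul_inv_mul R [a]
    rw [show invWord [a] = [invLetter a] from rfl] at h5
    calc _ = (val R [a] * val R [invLetter a] * val R [a]) * (val R z * val R (invWord y)) := by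
          simp only [y, val_append, mul_assoc]
      _ = _ := by rw [h5]; simp only [y, val_append, mul_assoc]
  calc val R w * val R [a] * val R [invLetter a]
      = val R w * (val R y * val R (invWord y)) * (val R [a] * val R [invLetter a]) := by
        rw [← h3, mul_assoc]
    _ = val R w * (val R y * val R (invWord y) * (val R [a] * val R [invLetter a])) := by
        simp only [mul_assoc]
    _ = val R w := by rw [h4, ← h3]

theorem eq_mul_val_of_reads {G : LGraph.{u, v} (X × Bool)} {φ : G.V → InvMonoid R}
    (hφ : ∀ p a q, G.Edge p a q → φ q = φ p * val R [a]) {p q : G.V} {w : List (X × Bool)}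
    (h : G.Reads p w q) : φ q = φ p * val R w := by
  induction w generalizing p with
  | nil => rw [← show p = q from h]; exact (mul_one _).symm
  | cons a w ih =>
    obtain ⟨x, h1, h2⟩ := h
    rw [ih h2, hφ _ _ _ h1, mul_assoc, ← val_append]; rfl

theorem cayley_reads_iff {m n : InvMonoid R} {w : List (X × Bool)} :
    (cayley R).Reads m w n ↔ n = m * val R w := by
  constructor
  · intro h
    exact eq_mul_val_of_reads (G := cayley R) (φ := id) (fun _ _ _ h => h) h
  · rintro rfl; exact cayley_reads R m w

end Monoid

/-! ## Recognizing the Schützenberger automaton -/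

section Schutzenberger

variable {X : Type u} {R : Set (List X × List X)}

theorem nonempty_iso_schutzenbergerAutomaton (t : List (X × Bool))
    (G : Birooted.{u, v} (X × Bool)) (hG : G.toLGraph.IsInverse)
    (hR : ∀ r s, (r, s) ∈ R → ∀ p q, G.Reads p (pos r) q ↔ G.Reads p (pos s) q)
    (hreach : ∀ p, ∃ w, G.Reads G.start w p) (ht : G.Reads G.start t G.final)
    (φ : G.V → InvMonoid R) (hφ : ∀ p a q, G.Edge p a q → φ q = φ p * val R [a])
    (hstart : φ G.start = val R (t ++ invWord t)) :
    Nonempty (Birooted.Iso G (schutzenbergerAutomaton R t)) := by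
  have hval {p : G.V} {w : List (X × Bool)} (h : G.Reads G.start w p) :
      φ p = val R (t ++ invWord t ++ w) := by
    rw [eq_mul_val_of_reads hφ h, hstart, ← val_append]
  have hfinal : φ G.final = val R t := by rw [hval ht, val_append, val_regular]
  -- The start is sent to `tt⁻¹` and not to `1`, so values of vertices are compared through words
  -- prefixed by `tt⁻¹`, which loops at the start.
  have hread {p : G.V} {w : List (X × Bool)} (h : G.Reads G.start w p) :
      G.Reads G.start (t ++ invWord t ++ w) p := by
    rw [LGraph.reads_append]
    exact ⟨_, hG.reads_append_invWord.2 ⟨rfl, _, ht⟩, h⟩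
  have hpath (p q : G.V) : ∃ w, φ q = φ p * val R w := by
    obtain ⟨w, hw⟩ := hreach p
    obtain ⟨z, hz⟩ := hreach q
    exact ⟨invWord w ++ z, eq_mul_val_of_reads hφ
      ((G.reads_append _ _ _ _).2 ⟨_, hG.reads_symm hw, hz⟩)⟩
  let f (p : G.V) : (schutzenbergerAutomaton R t).V :=
    ⟨φ p, by
      obtain ⟨w, hw⟩ := hpath G.final p
      exact ⟨w, cayley_reads_iff.2 (by rw [← hfinal, hw])⟩, by
      obtain ⟨w, hw⟩ := hpath p G.final
      exact ⟨w, cayley_reads_iff.2 (by rw [← hfinal, hw])⟩⟩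
  have hinj : Function.Injective f := by
    intro p q hpq
    have hpq : φ p = φ q := congrArg Subtype.val hpq
    obtain ⟨w, hw⟩ := hreach p
    obtain ⟨z, hz⟩ := hreach q
    rw [hval hw, hval hz] at hpq
    exact hG.reads_det (hread hw) ((hG.reads_iff_of_val_eq hR hpq _ _).2 (hread hz))
  have hsurj : Function.Surjective f := by
    rintro ⟨m, ⟨z, hz⟩, ⟨z', hz'⟩⟩
    obtain ⟨w, rfl⟩ := exists_val_eq R m
    replace hz := cayley_reads_iff.1 hz
    replace hz' := cayley_reads_iff.1 hz'
    rw [← val_append] at hz'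
    -- Here `t` equals `wz'` in the monoid. Since `t` is readable from the start, so is `wz'`, and
    -- the vertex reached after `w` is the preimage.
    have h1 := (hG.reads_iff_of_val_eq hR hz' _ _).1 ht
    rw [LGraph.reads_append] at h1
    obtain ⟨p, hp, -⟩ := h1
    refine ⟨p, Subtype.ext ?_⟩
    change φ p = val R w
    rw [hval hp, val_append, hz, ← mul_assoc, val_regular]
  refine ⟨⟨Equiv.ofBijective f ⟨hinj, hsurj⟩, ?_, Subtype.ext hstart, Subtype.ext hfinal⟩⟩
  intro p a q
  change φ q = φ p * val R [a] ↔ _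
  refine ⟨fun h => ?_, hφ p a q⟩
  obtain ⟨w, hw⟩ := hreach p
  obtain ⟨z, hz⟩ := hreach q
  rw [hval hw, hval hz, ← val_append] at h
  have h1 := (hG.reads_iff_of_val_eq hR h _ _).1 (hread hz)
  rw [LGraph.reads_append] at h1
  obtain ⟨p', hp', q', he, rfl⟩ := h1
  rwa [hG.reads_det (hread hw) hp']

theorem Birooted.Iso.isFinite {A : Type u} {G : Birooted.{u, v} A} {H : Birooted.{u, w} A}
    (e : Birooted.Iso G H) (hG : G.toLGraph.IsFinite) : H.toLGraph.IsFinite := by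
  obtain ⟨h1, h2⟩ := hG
  refine ⟨Finite.of_equiv _ e.toEquiv, (h2.image
    fun x => (e.toEquiv x.1, x.2.1, e.toEquiv x.2.2)).subset ?_⟩
  rintro ⟨p, a, q⟩ h
  refine ⟨(e.toEquiv.symm p, a, e.toEquiv.symm q), ?_, by simp⟩
  exact (e.edge_iff _ _ _).1 (by simpa using h)

end Schutzenberger

/-! ## Linear graphs of positive words -/

section Linear

variable {X : Type u}

theorem linear_symm {w : List (X × Bool)} {i j : (linear w).V} {a : X × Bool}
    (h : (linear w).Edge i a j) : (linear w).Edge j (invLetter a) i := by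
  rcases h with h | h
  · exact Or.inr (by rwa [invLetter_invLetter])
  · exact Or.inl h

theorem linear_pos_edge_true {w : List X} {i j : (linear (pos w)).V} {x : X} :
    (linear (pos w)).Edge i (x, true) j ↔ j.val = i.val + 1 ∧ w[i.val]? = some x := by
  simp [linear, pos, invLetter]

theorem linear_pos_reads_iff {w z : List X} {i j : (linear (pos w)).V} :
    (linear (pos w)).Reads i (pos z) j ↔ z <+: w.drop i.val ∧ j.val = i.val + z.length := by
  induction z generalizing i with
  | nil =>
    refine ⟨fun h => ?_, fun h => ?_⟩
    · obtain rfl : i = j := h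
      simp
    · exact Fin.ext (by simpa using h.2.symm)
  | cons x z ih =>
    have hlen : (pos w).length = w.length := List.length_map _
    constructor
    · rintro ⟨k, h1, h2⟩
      obtain ⟨hk, hx⟩ := linear_pos_edge_true.1 h1
      obtain ⟨h3, h4⟩ := ih.1 h2
      obtain ⟨hi, rfl⟩ := List.getElem?_eq_some_iff.1 hx
      rw [List.drop_eq_getElem_cons hi, List.cons_prefix_cons, List.length_cons]
      rw [hk] at h3
      exact ⟨⟨rfl, h3⟩, by omega⟩
    · rintro ⟨h, hj⟩
      have hi : i.val < w.length := by
        have := h.length_le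
        simp at this
        omega
      rw [List.drop_eq_getElem_cons hi, List.cons_prefix_cons] at h
      refine ⟨⟨i.val + 1, by omega⟩, linear_pos_edge_true.2 ⟨rfl, ?_⟩, ih.2 ⟨h.2, ?_⟩⟩
      · rw [List.getElem?_eq_getElem hi, h.1]
      · rw [List.length_cons] at hj
        change j.val = i.val + 1 + z.length
        omega

theorem linear_pos_reads_take {w : List X} (i : (linear (pos w)).V) :
    (linear (pos w)).Reads (linear (pos w)).start (pos (w.take i.val)) i := by
  have hlen : (pos w).length = w.length := List.length_map _
  have hi := i.isLt
  exact linear_pos_reads_iff.2 ⟨by simpa [linear] using List.take_prefix _ _,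
    by simp [linear]; omega⟩

theorem linear_pos_reads (w : List X) :
    (linear (pos w)).Reads (linear (pos w)).start (pos w) (linear (pos w)).final := by
  exact linear_pos_reads_iff.2 ⟨by simp [linear], by simp [linear, pos]⟩

/-- The alphabet may be infinite, so finiteness of the edge set needs a bound on the labels. -/
theorem linear_pos_edge_mem {w : List X} {i j : (linear (pos w)).V} {a : X × Bool}
    (h : (linear (pos w)).Edge i a j) : a.1 ∈ w := by
  rcases h with ⟨-, h⟩ | ⟨-, h⟩
  all_goals
    have h := List.mem_of_getElem? h
    obtain ⟨x, hx, hxa⟩ := List.mem_map.1 h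
  · rw [← hxa]; exact hx
  · rwa [show a.1 = x from congrArg Prod.fst hxa.symm]

end Linear

/-! ## Quotients and expansions -/

section Expansion

variable {A : Type u} {X : Type u}

/-- `Fold` is an equivalence relation by construction, so its quotient makes no further
identifications. -/
theorem quot_mk_fold_eq_iff {G : LGraph.{u, v} A} {p q : G.V} :
    Quot.mk (Fold G) p = Quot.mk (Fold G) q ↔ Fold G p q :=
  ⟨fun h => (Quotient.exact (s := ⟨Fold G, Fold.refl, Fold.symm, Fold.trans⟩) h), Quot.sound⟩

theorem determinize_det {G : Birooted.{u, v} A} {p q q' : (determinize G).V} {a : A}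
    (h : (determinize G).Edge p a q) (h' : (determinize G).Edge p a q') : q = q' := by
  obtain ⟨p1, q1, rfl, rfl, h1⟩ := h
  obtain ⟨p2, q2, h2, rfl, h3⟩ := h'
  exact Quot.sound (Fold.fold (Fold.symm (quot_mk_fold_eq_iff.1 h2)) h1 h3)

variable {R : Set (List X × List X)} {G : Birooted.{u, v} (X × Bool)}

theorem disjointUnion_edge_iff {x y : (disjointUnion R G).V} {a : X × Bool} :
    (disjointUnion R G).Edge x a y ↔
      (∃ p q, x = .inl p ∧ y = .inl q ∧ G.Edge p a q) ∨
      ∃ (σ : Site R G) (i j : (linear (pos σ.s)).V),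
        x = .inr ⟨σ, i⟩ ∧ y = .inr ⟨σ, j⟩ ∧ (linear (pos σ.s)).Edge i a j := by
  rcases x with p | x <;> rcases y with q | y
  · refine ⟨fun h => .inl ⟨p, q, rfl, rfl, h⟩, ?_⟩
    rintro (⟨p', q', h1, h2, h⟩ | ⟨σ, i, j, h1, h2, h⟩)
    · cases h1; cases h2; exact h
    · cases h1
  · refine ⟨False.elim, ?_⟩
    rintro (⟨p', q', h1, h2, h⟩ | ⟨σ, i, j, h1, h2, h⟩)
    · cases h2
    · cases h1
  · refine ⟨False.elim, ?_⟩
    rintro (⟨p', q', h1, h2, h⟩ | ⟨σ, i, j, h1, h2, h⟩)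
    · cases h1
    · cases h2
  · constructor
    · rintro ⟨σ, i, j, rfl, rfl, h⟩
      exact .inr ⟨σ, i, j, rfl, rfl, h⟩
    · rintro (⟨p', q', h1, h2, h⟩ | ⟨σ, i, j, h1, h2, h⟩)
      · cases h1
      · exact ⟨σ, i, j, Sum.inr_injective h1, Sum.inr_injective h2, h⟩

theorem disjointUnion_symm (hG : ∀ {p a q}, G.Edge p a q → G.Edge q (invLetter a) p)
    {x y : (disjointUnion R G).V} {a : X × Bool} (h : (disjointUnion R G).Edge x a y) :
    (disjointUnion R G).Edge y (invLetter a) x := by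
  rw [disjointUnion_edge_iff] at h ⊢
  rcases h with ⟨p, q, rfl, rfl, h⟩ | ⟨σ, i, j, rfl, rfl, h⟩
  · exact .inl ⟨q, p, rfl, rfl, hG h⟩
  · exact .inr ⟨σ, j, i, rfl, rfl, linear_symm h⟩

/-- The projection of the disjoint union onto the full `𝒫`-expansion. -/
def toFull (R : Set (List X × List X)) (G : Birooted.{u, v} (X × Bool))
    (x : (disjointUnion R G).V) : (fullExpansion R G).V :=
  Quot.mk _ (Quot.mk _ x)

theorem toFull_surjective : Function.Surjective (toFull R G) := by
  rintro ⟨⟨x⟩⟩; exact ⟨x, rfl⟩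

theorem toFull_sew {x y : (disjointUnion R G).V} (h : Sew R G x y) :
    toFull R G x = toFull R G y :=
  congrArg (Quot.mk _) (Quot.sound h)

theorem fullExpansion_edge_iff {p q : (fullExpansion R G).V} {a : X × Bool} :
    (fullExpansion R G).Edge p a q ↔
      ∃ x y, toFull R G x = p ∧ toFull R G y = q ∧ (disjointUnion R G).Edge x a y := by
  constructor
  · rintro ⟨_, _, rfl, rfl, x, y, rfl, rfl, h⟩
    exact ⟨x, y, rfl, rfl, h⟩
  · rintro ⟨x, y, rfl, rfl, h⟩
    exact ⟨_, _, rfl, rfl, x, y, rfl, rfl, h⟩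

theorem fullExpansion_isInverse (hG : ∀ {p a q}, G.Edge p a q → G.Edge q (invLetter a) p) :
    (fullExpansion R G).toLGraph.IsInverse where
  symm h := by
    rw [fullExpansion_edge_iff] at h ⊢
    obtain ⟨x, y, rfl, rfl, h⟩ := h
    exact ⟨y, x, rfl, rfl, disjointUnion_symm hG h⟩
  det h h' := determinize_det h h'

/-- The full `𝒫`-expansion is the universal deterministic image of the disjoint union in which the
identifications `Sew` hold. -/
theorem exists_lift_fullExpansion (H : LGraph.{u, w} (X × Bool))
    (hH : ∀ p a q q', H.Edge p a q → H.Edge p a q' → q = q')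
    (f : (disjointUnion R G).V → H.V)
    (hf : ∀ x a y, (disjointUnion R G).Edge x a y → H.Edge (f x) a (f y))
    (hsew : ∀ x y, Sew R G x y → f x = f y) :
    ∃ g : (fullExpansion R G).V → H.V, (∀ x, g (toFull R G x) = f x) ∧
      ∀ p a q, (fullExpansion R G).Edge p a q → H.Edge (g p) a (g q) := by
  let f' : (expandAll R G).V → H.V := Quot.lift f hsew
  have hf' : ∀ p a q, (expandAll R G).Edge p a q → H.Edge (f' p) a (f' q) := by
    rintro _ a _ ⟨x, y, rfl, rfl, h⟩
    exact hf x a y h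
  have hfold : ∀ p q, Fold (expandAll R G).toLGraph p q → f' p = f' q := by
    intro p q h
    induction h with
    | refl p => rfl
    | symm _ ih => exact ih.symm
    | trans _ _ ih ih' => exact ih.trans ih'
    -- Determinism of the target is exactly what lets a map survive folding.
    | fold _ h h' ih =>
      have h1 := hf' _ _ _ h
      rw [ih] at h1
      exact hH _ _ _ _ h1 (hf' _ _ _ h')
  refine ⟨Quot.lift f' hfold, fun _ => rfl, ?_⟩
  rintro _ a _ ⟨x, y, rfl, rfl, h⟩
  exact hf' x a y h

theorem reads_toFull_inl {p q : G.V} {w : List (X × Bool)} (h : G.Reads p w q) :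
    (fullExpansion R G).Reads (toFull R G (.inl p)) w (toFull R G (.inl q)) :=
  h.map (H := (fullExpansion R G).toLGraph) (fun p => toFull R G (.inl p))
    fun _ _ _ h => fullExpansion_edge_iff.2 ⟨_, _, rfl, rfl, h⟩

theorem reads_toFull_inr (σ : Site R G) {i j : (linear (pos σ.s)).V} {w : List (X × Bool)}
    (h : (linear (pos σ.s)).Reads i w j) :
    (fullExpansion R G).Reads (toFull R G (.inr ⟨σ, i⟩)) w (toFull R G (.inr ⟨σ, j⟩)) :=
  h.map (H := (fullExpansion R G).toLGraph) (fun i => toFull R G (.inr ⟨σ, i⟩))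
    fun _ _ _ h => fullExpansion_edge_iff.2
      ⟨_, _, rfl, rfl, disjointUnion_edge_iff.2 (.inr ⟨σ, _, _, rfl, rfl, h⟩)⟩

theorem fullExpansion_reach (hG : ∀ p, ∃ w, G.Reads G.start w p) (p : (fullExpansion R G).V) :
    ∃ w, (fullExpansion R G).Reads (fullExpansion R G).start w p := by
  obtain ⟨x, rfl⟩ := toFull_surjective p
  rcases x with p | ⟨σ, i⟩
  · obtain ⟨w, hw⟩ := hG p
    exact ⟨w, reads_toFull_inl hw⟩
  · obtain ⟨w, hw⟩ := hG σ.p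
    have h := reads_toFull_inr σ (linear_pos_reads_take i)
    rw [← toFull_sew (Sew.start σ)] at h
    exact ⟨_, (LGraph.reads_append _ _ _ _ _).2 ⟨_, reads_toFull_inl hw, h⟩⟩

end Expansion

/-! ## Finiteness -/

section Finiteness

variable {X : Type u} {R : Set (List X × List X)} {G : Birooted.{u, v} (X × Bool)}

theorem finite_site (hR : R.Finite) [Finite G.V] : Finite (Site R G) := by
  have h1 : {x : List X × List X | x ∈ R ∨ x.swap ∈ R}.Finite := by
    refine (hR.union (hR.image Prod.swap)).subset ?_
    rintro x (h | h)
    · exact .inl h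
    · exact .inr ⟨_, h, Prod.swap_swap x⟩
  have := h1.to_subtype
  let f (σ : Site R G) : {x : List X × List X | x ∈ R ∨ x.swap ∈ R} × G.V × G.V :=
    (⟨(σ.r, σ.s), σ.mem⟩, σ.p, σ.q)
  refine Finite.of_injective f ?_
  rintro ⟨r, s, p, q, h1, h2, h3⟩ ⟨r', s', p', q', h1', h2', h3'⟩ h
  simp only [f, Prod.mk.injEq, Subtype.mk.injEq] at h
  obtain ⟨⟨rfl, rfl⟩, rfl, rfl⟩ := h
  rfl

theorem fullExpansion_isFinite (hR : R.Finite) [Finite G.V] {L : Set X} (hL : L.Finite)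
    (hG : ∀ p a q, G.Edge p a q → a.1 ∈ L) : (fullExpansion R G).toLGraph.IsFinite := by
  have := finite_site (G := G) hR
  have hlin (w : List (X × Bool)) : Finite (linear w).V := inferInstanceAs (Finite (Fin _))
  have : Finite (disjointUnion R G).V :=
    inferInstanceAs (Finite (G.V ⊕ (Σ σ : Site R G, (linear (pos σ.s)).V)))
  have hV : Finite (fullExpansion R G).V := Finite.of_surjective _ toFull_surjective
  refine ⟨hV, ?_⟩
  -- All labels come from the original graph or from the finitely many sewn words.
  let L' : Set X := L ∪ ⋃ σ : Site R G, {x | x ∈ σ.s}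
  have hL' : L'.Finite := hL.union (Set.finite_iUnion fun σ => List.finite_toSet σ.s)
  refine (Set.finite_univ.prod ((hL'.prod (Set.finite_univ (α := Bool))).prod
    Set.finite_univ)).subset ?_
  rintro ⟨p, a, q⟩ h
  refine ⟨trivial, ⟨?_, trivial⟩, trivial⟩
  obtain ⟨x, y, -, -, h⟩ := fullExpansion_edge_iff.1 h
  rcases disjointUnion_edge_iff.1 h with ⟨p, q, -, -, h⟩ | ⟨σ, i, j, -, -, h⟩
  · exact .inl (hG _ _ _ h)
  · exact .inr (Set.mem_iUnion.2 ⟨σ, linear_pos_edge_mem h⟩)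

end Finiteness

/-! ## The map to the inverse monoid -/

section ToMonoid

variable {X : Type u} {R : Set (List X × List X)} {t : List X}

theorem val_rel_or {r s : List X} (h : (r, s) ∈ R ∨ (s, r) ∈ R) :
    val R (pos r) = val R (pos s) :=
  h.elim (val_rel R) fun h => (val_rel R h).symm

/-- Compatibility with positive edges suffices when all values are mutually reachable with `m` by
right multiplication: `mul_val_invLetter` then handles the inverse edges. -/
theorem map_edge_of_forward {G : LGraph.{u, v} (X × Bool)}
    (hG : ∀ {p a q}, G.Edge p a q → G.Edge q (invLetter a) p) {φ : G.V → InvMonoid R}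
    (hφ : ∀ p x q, G.Edge p (x, true) q → φ q = φ p * val R [(x, true)])
    (m : InvMonoid R) (h1 : ∀ p, ∃ n, φ p * n = m) (h2 : ∀ p, ∃ n, m * n = φ p)
    (p : G.V) (a : X × Bool) (q : G.V) (h : G.Edge p a q) : φ q = φ p * val R [a] := by
  obtain ⟨x, b⟩ := a
  cases b with
  | true => exact hφ p x q h
  | false =>
    have h' := hφ q x p (hG h)
    obtain ⟨n, hn⟩ := h1 p
    obtain ⟨n', hn'⟩ := h2 q
    rw [h']
    refine (mul_val_invLetter (a := (x, true)) (n := n * n') ?_).symm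
    rw [← h', ← mul_assoc, hn, hn']

theorem val_pos_take_succ {w : List X} {i : ℕ} {x : X} (h : w[i]? = some x) :
    val R (pos (w.take (i + 1))) = val R (pos (w.take i)) * val R [(x, true)] := by
  rw [List.take_add_one, h, pos_append, val_append]; rfl

theorem exists_map_fullExpansion_linear (R : Set (List X × List X)) (t : List X) :
    ∃ φ : (fullExpansion R (linear (pos t))).V → InvMonoid R,
      (∀ p a q, (fullExpansion R (linear (pos t))).Edge p a q → φ q = φ p * val R [a]) ∧
      φ (fullExpansion R (linear (pos t))).start = val R (pos t ++ invWord (pos t)) := by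
  let e := val R (pos t ++ invWord (pos t))
  have he : e * val R (pos t) = val R (pos t) := val_regular R _
  -- Each vertex receives `tt⁻¹` times the label of a path to it from the start: along `t`, or along
  -- `t` to the site and then along the sewn word.
  let f : (disjointUnion R (linear (pos t))).V → InvMonoid R
    | .inl i => e * val R (pos (t.take i.val))
    | .inr ⟨σ, j⟩ => e * val R (pos (t.take σ.p.val)) * val R (pos (σ.s.take j.val))
  have hlen (w : List X) : (pos w).length = w.length := List.length_map _
  -- The two routes to the end of a site agree because both sides of the relation have the same
  -- value; this makes the sewing at the end consistent.
  have hq (σ : Site R (linear (pos t))) :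
      e * val R (pos (t.take σ.q.val)) =
        e * val R (pos (t.take σ.p.val)) * val R (pos σ.s) := by
    obtain ⟨⟨z, h1⟩, h2⟩ := linear_pos_reads_iff.1 σ.reads
    rw [h2, List.take_add, ← h1, List.take_left, pos_append, val_append, mul_assoc,
      val_rel_or σ.mem]
  have hright (i : (linear (pos t)).V) : ∃ n, f (.inl i) * n = val R (pos t) := by
    refine ⟨val R (pos (t.drop i.val)), ?_⟩
    change e * _ * _ = _
    rw [mul_assoc, ← val_append, ← pos_append, List.take_append_drop, he]
  have hleft (x) : ∃ n, val R (pos t) * n = f x := by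
    rcases x with i | ⟨σ, j⟩
    · refine ⟨val R (invWord (pos t)) * val R (pos (t.take i.val)), ?_⟩
      rw [← mul_assoc, ← val_append]
    · refine ⟨val R (invWord (pos t)) * val R (pos (t.take σ.p.val)) *
        val R (pos (σ.s.take j.val)), ?_⟩
      rw [← mul_assoc, ← mul_assoc, ← val_append]
  have hforward : ∀ x a y, (disjointUnion R (linear (pos t))).Edge x (a, true) y →
      f y = f x * val R [(a, true)] := by
    intro p x q h
    rcases disjointUnion_edge_iff.1 h with ⟨p, q, rfl, rfl, h⟩ | ⟨σ, i, j, rfl, rfl, h'⟩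
    · obtain ⟨h1, h2⟩ := linear_pos_edge_true.1 h
      simp only [f, h1, val_pos_take_succ h2, mul_assoc]
    · obtain ⟨h1, h2⟩ := linear_pos_edge_true.1 h'
      simp only [f, h1, val_pos_take_succ h2, mul_assoc]
  have hright' (x) : ∃ n, f x * n = val R (pos t) := by
    rcases x with i | ⟨σ, j⟩
    · exact hright i
    · obtain ⟨n, hn⟩ := hright σ.q
      refine ⟨val R (pos (σ.s.drop j.val)) * n, ?_⟩
      rw [← hn]
      change e * _ * _ * (_ * n) = e * _ * n
      rw [hq]
      conv_rhs => rw [← List.take_append_drop j.val σ.s, pos_append, val_append]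
      simp only [mul_assoc]
  have hsew : ∀ x y, Sew R (linear (pos t)) x y → f x = f y := by
    rintro _ _ (σ | σ)
    · change e * _ = e * _ * val R (pos (σ.s.take 0))
      simp only [List.take_zero]
      exact (mul_one _).symm
    · change e * _ = e * _ * val R (pos (σ.s.take (pos σ.s).length))
      rw [List.take_of_length_le (hlen σ.s).ge, hq]
  obtain ⟨φ, h1, h2⟩ := exists_lift_fullExpansion (G := linear (pos t)) (cayley R)
    (fun _ _ _ _ h h' => h.trans h'.symm) f
    (map_edge_of_forward (disjointUnion_symm linear_symm) hforward _ hright' hleft) hsew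
  refine ⟨φ, h2, (h1 (.inl (linear (pos t)).start)).trans ?_⟩
  change e * val R (pos (t.take 0)) = e
  simp only [List.take_zero]
  exact mul_one e

end ToMonoid

/-! ## A model of the expansion of a linear graph -/

section Model

variable {X : Type u}

/-- Sets of positive relations whose sides have no factors and no overlaps among each other, and
in which the two sides of a relation have distinct first and distinct last letters. -/
structure IsRigid (R : Set (List X × List X)) : Prop where
  head : ∀ {r s}, (r, s) ∈ R ∨ (s, r) ∈ R → r.head? ≠ s.head?
  getLast : ∀ {r s}, (r, s) ∈ R ∨ (s, r) ∈ R → r.getLast? ≠ s.getLast?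
  ne_nil : ∀ {r s}, (r, s) ∈ R ∨ (s, r) ∈ R → s ≠ []
  infix_eq : ∀ {r s r' s'}, (r, s) ∈ R ∨ (s, r) ∈ R → (r', s') ∈ R ∨ (s', r') ∈ R →
    r <:+: r' → r = r' ∧ s = s'
  not_overlaps : ∀ {r s r' s'}, (r, s) ∈ R ∨ (s, r) ∈ R → (r', s') ∈ R ∨ (s', r') ∈ R →
    ¬ Overlaps r r'

/-- `(r, s)` is a relation, read in either direction, and `r` occurs in `t` at the position `i`. -/
def OccursAt (R : Set (List X × List X)) (t : List X) (i : ℕ) (r s : List X) : Prop :=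
  ((r, s) ∈ R ∨ (s, r) ∈ R) ∧ r <+: t.drop i

/-- The vertex reached after `k` letters of the path labeled `s` that is sewn on from `i` to
`i + r.length`. -/
def sidePos (i : ℕ) (r s : List X) (k : ℕ) : ℕ × ℕ :=
  if k = s.length then (i + r.length, 0) else (i, k)

/-- The positive edges of the graph obtained from the linear graph of `t` by sewing on `s` along
every occurrence of `r` in `t`, for all relations `(r, s)`. -/
inductive ModelStep (R : Set (List X × List X)) (t : List X) : ℕ × ℕ → X → ℕ × ℕ → Prop
  | base {i : ℕ} {x : X} (h : t[i]? = some x) : ModelStep R t (i, 0) x (i + 1, 0)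
  | side {i k : ℕ} {r s : List X} {x : X} (h : OccursAt R t i r s) (hx : s[k]? = some x) :
      ModelStep R t (i, k) x (sidePos i r s (k + 1))

/-- The graph obtained from the linear graph of `t` by sewing on `s` along every occurrence of `r`
in `t`, for all relations `(r, s)`. -/
def model (R : Set (List X × List X)) (t : List X) : LGraph.{u, 0} (X × Bool) where
  V := ℕ × ℕ
  Edge p a q := (a.2 = true ∧ ModelStep R t p a.1 q) ∨ (a.2 = false ∧ ModelStep R t q a.1 p)

variable {R : Set (List X × List X)} {t : List X}

/-- Two words occurring at the same position are comparable as prefixes, so one is a factor of the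
other. -/
theorem IsRigid.occursAt_unique (hR : IsRigid R) {i : ℕ} {r s r' s' : List X}
    (h : OccursAt R t i r s) (h' : OccursAt R t i r' s') : r = r' ∧ s = s' := by
  rcases List.prefix_or_prefix_of_prefix h.2 h'.2 with h1 | h1
  · exact hR.infix_eq h.1 h'.1 h1.isInfix
  · have := hR.infix_eq h'.1 h.1 h1.isInfix
    exact ⟨this.1.symm, this.2.symm⟩

theorem OccursAt.getElem? {i k : ℕ} {r s : List X} (h : OccursAt R t i r s) (hk : k < r.length) :
    t[i + k]? = r[k]? := by
  obtain ⟨z, hz⟩ := h.2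
  rw [← List.getElem?_drop, ← hz, List.getElem?_append_left hk]

theorem IsRigid.pos_left (hR : IsRigid R) {i : ℕ} {r s : List X} (h : OccursAt R t i r s) :
    0 < r.length := List.length_pos_of_ne_nil (hR.ne_nil h.1.symm)

theorem IsRigid.pos_right (hR : IsRigid R) {i : ℕ} {r s : List X} (h : OccursAt R t i r s) :
    0 < s.length := List.length_pos_of_ne_nil (hR.ne_nil h.1)

theorem IsRigid.occursAt_end_unique (hR : IsRigid R) {i i' : ℕ} {r s r' s' : List X}
    (h : OccursAt R t i r s) (h' : OccursAt R t i' r' s')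
    (he : i + r.length = i' + r'.length) : i = i' ∧ r = r' ∧ s = s' := by
  wlog hle : i' ≤ i generalizing i i' r s r' s'
  · obtain ⟨h1, h2, h3⟩ := this h' h he.symm (by omega)
    exact ⟨h1.symm, h2.symm, h3.symm⟩
  have hlen := h.2.length_le
  -- With equal ends, the occurrence that starts later is a suffix of the other.
  have hsuf : r <:+: r' := by
    have h1 : r' = (t.drop i').take r'.length := (List.prefix_iff_eq_take.1 h'.2)
    have h2 : r = (t.drop i).take r.length := (List.prefix_iff_eq_take.1 h.2)
    have h3 : r = r'.drop (i - i') := by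
      rw [h1, List.drop_take, List.drop_drop, show i' + (i - i') = i by omega,
        show r'.length - (i - i') = r.length by omega]
      exact h2
    rw [h3]
    exact (List.drop_suffix _ _).isInfix
  obtain ⟨rfl, rfl⟩ := hR.infix_eq h.1 h'.1 hsuf
  exact ⟨by omega, rfl, rfl⟩

/-- Branching happens only at the start of an occurrence, between `t` and the sewn path, and their
first letters differ. -/
theorem ModelStep.functional (hR : IsRigid R) {p q q' : ℕ × ℕ} {x : X}
    (h : ModelStep R t p x q) (h' : ModelStep R t p x q') : q = q' := by
  have key {i : ℕ} {r s : List X} (h1 : t[i]? = some x) (h2 : OccursAt R t i r s)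
      (h3 : s[0]? = some x) : False := by
    have h4 := h2.getElem? (hR.pos_left h2)
    refine hR.head h2.1 ?_
    rw [List.head?_eq_getElem?, List.head?_eq_getElem?, ← h4, h3]
    exact h1
  cases h with
  | base h =>
    cases h' with
    | base h' => rfl
    | side h1 h2 => exact (key h h1 h2).elim
  | side h1 h2 =>
    cases h' with
    | base h' => exact (key h' h1 h2).elim
    | side h3 h4 =>
      obtain ⟨rfl, rfl⟩ := hR.occursAt_unique h1 h3
      rfl

/-- The mirror image of `ModelStep.functional`: paths merge only at the end of an occurrence, where
last letters differ. This is determinism for inverse letters. -/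
theorem ModelStep.injective (hR : IsRigid R) {p p' q : ℕ × ℕ} {x : X}
    (h : ModelStep R t p x q) (h' : ModelStep R t p' x q) : p = p' := by
  have key {i j k : ℕ} {r s : List X} (h1 : t[i]? = some x) (h2 : OccursAt R t j r s)
      (h3 : s[k]? = some x) (h4 : (i + 1, 0) = sidePos j r s (k + 1)) : False := by
    have hr := hR.pos_left h2
    unfold sidePos at h4
    split_ifs at h4 with h5
    · simp only [Prod.mk.injEq, and_true] at h4
      refine hR.getLast h2.1 ?_
      rw [List.getLast?_eq_getElem?, List.getLast?_eq_getElem?, ← h5, Nat.add_sub_cancel, h3,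
        ← h2.getElem? (by omega), ← h1]
      congr 1
      omega
    · simp at h4
  generalize hq : q = y at h'
  cases h with
  | base h =>
    cases h' with
    | base h' => simp only [Prod.mk.injEq, and_true, add_left_inj] at hq; rw [hq]
    | side h1 h2 => exact (key h h1 h2 hq).elim
  | side h1 h2 =>
    cases h' with
    | base h' => exact (key h' h1 h2 hq.symm).elim
    | side h3 h4 =>
      unfold sidePos at hq
      split_ifs at hq with h5 h6 h6
      · simp only [Prod.mk.injEq, and_true] at hq
        obtain ⟨rfl, rfl, rfl⟩ := hR.occursAt_end_unique h1 h3 hq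
        simp only [Prod.mk.injEq, true_and]
        omega
      · simp at hq
      · simp at hq
      · simpa using hq

theorem model_det (hR : IsRigid R) (p : (model R t).V) (a : X × Bool) (q q' : (model R t).V)
    (h : (model R t).Edge p a q) (h' : (model R t).Edge p a q') : q = q' := by
  rcases h with ⟨ha, h⟩ | ⟨ha, h⟩ <;> rcases h' with ⟨ha', h'⟩ | ⟨ha', h'⟩
  · exact h.functional hR h'
  · simp [ha] at ha'
  · simp [ha] at ha'
  · exact h.injective hR h'

theorem model_reads_cons {p q : ℕ × ℕ} {x : X} {w : List X} :
    (model R t).Reads p (pos (x :: w)) q ↔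
      ∃ y, ModelStep R t p x y ∧ (model R t).Reads y (pos w) q := by
  simp [pos, LGraph.Reads, model]

theorem model_reads_base {i : ℕ} {w : List X} (h : w <+: t.drop i) :
    (model R t).Reads (i, 0) (pos w) (i + w.length, 0) := by
  induction w generalizing i with
  | nil => rfl
  | cons x w ih =>
    have hi : i < t.length := by
      have := h.length_le
      simp at this
      omega
    rw [List.drop_eq_getElem_cons hi, List.cons_prefix_cons] at h
    rw [model_reads_cons]
    refine ⟨_, .base ?_, ?_⟩
    · rw [List.getElem?_eq_getElem hi, h.1]
    · rw [List.length_cons, show i + (w.length + 1) = i + 1 + w.length by omega]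
      exact ih h.2

theorem sidePos_of_lt {i k : ℕ} {r s : List X} (hk : k < s.length) :
    sidePos i r s k = (i, k) := if_neg hk.ne

theorem model_reads_side {i k : ℕ} {r s w : List X} (h : OccursAt R t i r s)
    (hw : w <+: s.drop k) :
    (model R t).Reads (sidePos i r s k) (pos w) (sidePos i r s (k + w.length)) := by
  induction w generalizing k with
  | nil => rfl
  | cons x w ih =>
    have hi : k < s.length := by
      have := hw.length_le
      simp at this
      omega
    rw [List.drop_eq_getElem_cons hi, List.cons_prefix_cons] at hw
    refine model_reads_cons.2 ⟨sidePos i r s (k + 1), ?_, ?_⟩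
    · rw [sidePos_of_lt hi]
      exact .side h (by rw [List.getElem?_eq_getElem hi, hw.1])
    · rw [List.length_cons, show k + (w.length + 1) = k + 1 + w.length by omega]
      exact ih hw.2

theorem model_reads_side_full (hR : IsRigid R) {i : ℕ} {r s : List X} (h : OccursAt R t i r s) :
    (model R t).Reads (i, 0) (pos s) (i + r.length, 0) := by
  have h1 := model_reads_side h (k := 0) (w := s) (by simp)
  rw [sidePos_of_lt (hR.pos_right h)] at h1
  simpa only [sidePos, Nat.zero_add, if_true] using h1

/-- A path that starts on a sewn on path follows it to its end. -/
theorem IsRigid.prefix_of_model_reads_side (hR : IsRigid R) {i k : ℕ} {r s w : List X}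
    {y : ℕ × ℕ} (h : OccursAt R t i r s) (hk : 0 < k) (hks : k ≤ s.length)
    (hw : (model R t).Reads (sidePos i r s k) (pos w) y) :
    (w <+: s.drop k ∧ y = sidePos i r s (k + w.length)) ∨
      (s.drop k <+: w ∧ s.drop k ≠ w) := by
  induction w generalizing k with
  | nil =>
    left
    exact ⟨List.nil_prefix, (show sidePos i r s k = y from hw).symm⟩
  | cons x w ih =>
    rcases hks.eq_or_lt with rfl | hlt
    · right
      simp
    · obtain ⟨z, hz, hw'⟩ := model_reads_cons.1 hw
      rw [sidePos, if_neg hlt.ne] at hz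
      generalize hp : ((i, k) : ℕ × ℕ) = p at hz
      cases hz with
      -- Base edges start at second coordinate `0`, so an inner vertex can only be left along its
      -- own sewn path.
      | base => simp at hp; omega
      | @side i' k' r' s' _ h' hx =>
        obtain ⟨rfl, rfl⟩ := Prod.mk.inj hp
        obtain ⟨rfl, rfl⟩ := hR.occursAt_unique h h'
        obtain ⟨_, rfl⟩ := List.getElem?_eq_some_iff.1 hx
        rw [List.drop_eq_getElem_cons hlt, List.cons_prefix_cons, List.cons_prefix_cons,
          List.length_cons, show k + (w.length + 1) = k + 1 + w.length by omega]
        rcases ih (Nat.succ_pos k) hlt hw' with h1 | h1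
        · exact .inl ⟨⟨rfl, h1.1⟩, h1.2⟩
        · exact .inr ⟨⟨rfl, h1.1⟩, fun he => h1.2 (List.cons.inj he).2⟩

/-- A path that starts on the linear graph of `t` either stays there or leaves it along a sewn on
path. -/
theorem IsRigid.model_reads_base_cases (hR : IsRigid R) {i : ℕ} {w : List X} {y : ℕ × ℕ}
    (hw : (model R t).Reads (i, 0) (pos w) y) :
    (w <+: t.drop i ∧ y = (i + w.length, 0)) ∨
      ∃ α β r s, w = α ++ β ∧ β ≠ [] ∧ OccursAt R t (i + α.length) r s ∧
        ((β <+: s ∧ y = sidePos (i + α.length) r s β.length) ∨ (s <+: β ∧ s ≠ β)) := by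
  induction w generalizing i with
  | nil =>
    left
    exact ⟨List.nil_prefix, (show ((i, 0) : ℕ × ℕ) = y from hw).symm⟩
  | cons x w ih =>
    obtain ⟨z, hz, hw'⟩ := model_reads_cons.1 hw
    generalize hp : ((i, 0) : ℕ × ℕ) = p at hz
    cases hz with
    | @base i' _ hx =>
      obtain ⟨rfl, -⟩ := Prod.mk.inj hp
      obtain ⟨hi, rfl⟩ := List.getElem?_eq_some_iff.1 hx
      rcases ih hw' with h1 | ⟨α, β, r, s, rfl, h1, h2, h3⟩
      · left
        rw [List.drop_eq_getElem_cons hi, List.cons_prefix_cons, List.length_cons,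
          show i + (w.length + 1) = i + 1 + w.length by omega]
        exact ⟨⟨rfl, h1.1⟩, h1.2⟩
      · refine .inr ⟨t[i] :: α, β, r, s, rfl, h1, ?_⟩
        rw [List.length_cons, show i + (α.length + 1) = i + 1 + α.length by omega]
        exact ⟨h2, h3⟩
    | @side i' k r s _ h hx =>
      obtain ⟨rfl, rfl⟩ := Prod.mk.inj hp
      obtain ⟨hi, rfl⟩ := List.getElem?_eq_some_iff.1 hx
      refine .inr ⟨[], s[0] :: w, r, s, rfl, by simp, h, ?_⟩
      have hs : s = s[0] :: s.drop 1 := by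
        conv_lhs => rw [← List.drop_zero (l := s), List.drop_eq_getElem_cons hi]
      rcases hR.prefix_of_model_reads_side h Nat.one_pos hi hw' with h1 | h1
      · left
        refine ⟨?_, by rw [h1.2, List.length_cons, add_comm]; rfl⟩
        conv_rhs => rw [hs]
        exact List.cons_prefix_cons.2 ⟨rfl, h1.1⟩
      · right
        constructor
        · conv_lhs => rw [hs]
          exact List.cons_prefix_cons.2 ⟨rfl, h1.1⟩
        · intro he
          exact h1.2 (List.cons.inj (hs.symm.trans he)).2

/-- In the model the two sides of a relation label the same paths. -/
theorem IsRigid.model_closed (hR : IsRigid R) {r s : List X} (hrs : (r, s) ∈ R ∨ (s, r) ∈ R)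
    {p q : ℕ × ℕ} (h : (model R t).Reads p (pos r) q) : (model R t).Reads p (pos s) q := by
  have hr : r ≠ [] := hR.ne_nil hrs.symm
  obtain ⟨i, k⟩ := p
  rcases Nat.eq_zero_or_pos k with rfl | hk
  · rcases hR.model_reads_base_cases h with ⟨h1, rfl⟩ | ⟨α, β, r', s', rfl, hβ, h1, h2⟩
    · exact model_reads_side_full hR ⟨hrs, h1⟩
    · rcases h2 with ⟨h2, rfl⟩ | ⟨h2, h3⟩
      · by_cases hα : α = []
        · subst hα
          -- The path is the entire sewn word `s' = r`, so its partner `s = r'` is read along `t`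
          -- between the same ends.
          obtain ⟨h3, rfl⟩ := hR.infix_eq hrs h1.1.symm h2.isInfix
          obtain rfl : β = s' := h3
          rw [sidePos, if_pos rfl]
          exact model_reads_base h1.2
        · by_cases hβs : β = s'
          · subst hβs
            have := (hR.infix_eq h1.1.symm hrs (List.suffix_append α β).isInfix).1
            simp [hα] at this
          · obtain ⟨z, hz⟩ := h2
            -- The path ends strictly inside a sewn word after a nonempty stretch of `t`, so `r`
            -- overlaps `s'`.
            refine (hR.not_overlaps hrs h1.1.symm ⟨α, β, z, hα, hβ, ?_, rfl, hz.symm⟩).elim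
            rintro rfl
            exact hβs (by simpa using hz)
      -- The path runs past the end of the sewn word, making `s'` a factor of `r` that is too short
      -- to equal it.
      · have h4 := (hR.infix_eq h1.1.symm hrs
          (h2.isInfix.trans (List.suffix_append α β).isInfix)).1
        have h5 := h2.length_le
        have h6 := congrArg List.length h4
        rw [List.length_append] at h6
        exact (h3 (h2.eq_of_length (by omega))).elim
  · exfalso
    obtain ⟨x, w, rfl⟩ := List.exists_cons_of_ne_nil hr
    have h' := h
    obtain ⟨z, hz, -⟩ := model_reads_cons.1 h'
    generalize hp : ((i, k) : ℕ × ℕ) = p at hz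
    cases hz with
    | base => simp at hp; omega
    | @side i' k' r' s' _ h1 hx =>
      obtain ⟨rfl, rfl⟩ := Prod.mk.inj hp
      obtain ⟨hi, -⟩ := List.getElem?_eq_some_iff.1 hx
      have hne : (s'.drop k).length < s'.length := by simp; omega
      have hpk : sidePos i r' s' k = (i, k) := if_neg hi.ne
      rw [← hpk] at h
      -- Starting inside a sewn word, the path either stays there, making `r` a factor of a proper
      -- suffix of `s'`, or leaves it, making `s'` overlap `r`.
      rcases hR.prefix_of_model_reads_side h1 hk hi.le h with ⟨h2, -⟩ | ⟨h2, h3⟩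
      · have h4 := (hR.infix_eq hrs h1.1.symm (h2.isInfix.trans (List.drop_suffix _ _).isInfix)).1
        have := h2.length_le
        rw [h4] at this
        exact Nat.not_le_of_lt hne this
      · obtain ⟨z, hz⟩ := h2
        refine hR.not_overlaps h1.1.symm hrs ⟨s'.take k, s'.drop k, z, ?_, ?_, ?_,
          (List.take_append_drop k s').symm, hz.symm⟩
        · intro he
          rcases List.take_eq_nil_iff.1 he with h4 | rfl
          · exact hk.ne' h4
          · exact Nat.not_lt_zero _ hi
        · intro he
          exact hi.not_ge (List.drop_eq_nil_iff.1 he)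
        · rintro rfl
          exact h3 (by simpa using hz)

end Model

/-! ## The expansion of a linear graph is closed -/

section Closed

variable {X : Type u} {R : Set (List X × List X)} {t : List X}

theorem Site.occursAt (σ : Site R (linear (pos t))) : OccursAt R t σ.p.val σ.r σ.s :=
  ⟨σ.mem, (linear_pos_reads_iff.1 σ.reads).1⟩

theorem Site.q_val (σ : Site R (linear (pos t))) : σ.q.val = σ.p.val + σ.r.length :=
  (linear_pos_reads_iff.1 σ.reads).2

/-- Every occurrence really triggers an expansion: if `s` were already readable there, `r` and `s`
would occur at one position and coincide, against their distinct first letters. -/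
theorem OccursAt.exists_site (hR : IsRigid R) {i : ℕ} {r s : List X} (h : OccursAt R t i r s) :
    ∃ σ : Site R (linear (pos t)), σ.p.val = i ∧ σ.r = r ∧ σ.s = s := by
  have hlen : (pos t).length = t.length := List.length_map _
  have h1 := h.2.length_le
  have h2 := hR.pos_left h
  rw [List.length_drop] at h1
  refine ⟨⟨r, s, ⟨i, by omega⟩, ⟨i + r.length, by omega⟩, h.1,
    linear_pos_reads_iff.2 ⟨h.2, rfl⟩, fun h3 => ?_⟩, rfl, rfl, rfl⟩
  have h4 : OccursAt R t i s r := ⟨h.1.symm, (linear_pos_reads_iff.1 h3).1⟩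
  exact hR.head h.1 (by rw [(hR.occursAt_unique h h4).1])

theorem Site.ext_of_p (hR : IsRigid R) {σ σ' : Site R (linear (pos t))}
    (h : σ.p.val = σ'.p.val) : σ = σ' := by
  have h1 := σ.occursAt
  rw [h] at h1
  obtain ⟨hr, hs⟩ := hR.occursAt_unique h1 σ'.occursAt
  have hp : σ.p = σ'.p := Fin.ext h
  have hq : σ.q = σ'.q := Fin.ext (by rw [σ.q_val, σ'.q_val, h, hr])
  obtain ⟨r, s, p, q, _, _, _⟩ := σ
  obtain ⟨r', s', p', q', _, _, _⟩ := σ'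
  obtain rfl : r = r' := hr
  obtain rfl : s = s' := hs
  obtain rfl : p = p' := hp
  obtain rfl : q = q' := hq
  rfl

/-- The map from the pieces of the expansion of a linear graph to the model. -/
def toModel (R : Set (List X × List X)) (t : List X) :
    (disjointUnion R (linear (pos t))).V → ℕ × ℕ
  | .inl i => (i.val, 0)
  | .inr ⟨σ, j⟩ => sidePos σ.p.val σ.r σ.s j.val

theorem toModel_edge {x y : (disjointUnion R (linear (pos t))).V} {a : X × Bool}
    (h : (disjointUnion R (linear (pos t))).Edge x a y) :
    (model R t).Edge (toModel R t x) a (toModel R t y) := by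
  have key {x y : (disjointUnion R (linear (pos t))).V} {a : X}
      (h : (disjointUnion R (linear (pos t))).Edge x (a, true) y) :
      ModelStep R t (toModel R t x) a (toModel R t y) := by
    rcases disjointUnion_edge_iff.1 h with ⟨p, q, rfl, rfl, h'⟩ | ⟨σ, i, j, rfl, rfl, h'⟩
    · obtain ⟨h1, h2⟩ := linear_pos_edge_true.1 h'
      simp only [toModel, h1]
      exact .base h2
    · obtain ⟨h1, h2⟩ := linear_pos_edge_true.1 h'
      simp only [toModel, h1]
      rw [sidePos_of_lt (List.getElem?_eq_some_iff.1 h2).1]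
      exact .side σ.occursAt h2
  obtain ⟨x', b⟩ := a
  cases b with
  | true => exact .inl ⟨rfl, key h⟩
  | false => exact .inr ⟨rfl, key (disjointUnion_symm linear_symm h)⟩

theorem toModel_sew (hR : IsRigid R) {x y : (disjointUnion R (linear (pos t))).V}
    (h : Sew R (linear (pos t)) x y) : toModel R t x = toModel R t y := by
  rcases h with σ | σ
  · change _ = sidePos _ _ _ 0
    rw [sidePos_of_lt (hR.pos_right σ.occursAt)]; rfl
  · change (σ.q.val, 0) = sidePos _ _ _ (pos σ.s).length
    have hlen : (pos σ.s).length = σ.s.length := List.length_map _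
    rw [sidePos, if_pos hlen]
    exact Prod.ext σ.q_val rfl

/-- Every vertex of the expansion is the image of a vertex of the linear graph or of an inner
vertex of a sewn on path. -/
theorem toFull_eq_inl_or_inner (x : (disjointUnion R (linear (pos t))).V) :
    (∃ i, toFull R (linear (pos t)) x = toFull R (linear (pos t)) (.inl i)) ∨
      ∃ σ j, x = .inr ⟨σ, j⟩ ∧ 0 < j.val ∧ j.val < σ.s.length := by
  rcases x with i | ⟨σ, j⟩
  · exact .inl ⟨i, rfl⟩
  · have hj := j.isLt
    have hlen : (pos σ.s).length = σ.s.length := List.length_map _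
    rcases Nat.eq_zero_or_pos j.val with h | h
    · left
      obtain rfl : j = (linear (pos σ.s)).start := Fin.ext h
      exact ⟨_, (toFull_sew (Sew.start σ)).symm⟩
    · by_cases h' : j.val < σ.s.length
      · exact .inr ⟨σ, j, rfl, h, h'⟩
      · left
        obtain rfl : j = (linear (pos σ.s)).final := Fin.ext (by simp [linear]; omega)
        exact ⟨_, (toFull_sew (Sew.final σ)).symm⟩

/-- This makes the map from the expansion to the model injective. Vertices reduce to base vertices
and inner vertices of sewn paths; the model separates the two kinds by the second coordinate, and
the first coordinate determines the site. -/
theorem toFull_eq_of_toModel_eq (hR : IsRigid R) {x y : (disjointUnion R (linear (pos t))).V}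
    (h : toModel R t x = toModel R t y) :
    toFull R (linear (pos t)) x = toFull R (linear (pos t)) y := by
  obtain ⟨g, hg, -⟩ := exists_lift_fullExpansion (G := linear (pos t)) (model R t)
    (model_det hR) (toModel R t) (fun _ _ _ => toModel_edge) (fun _ _ => toModel_sew hR)
  have hgx : g (toFull R _ x) = g (toFull R _ y) := (hg x).trans (h.trans (hg y).symm)
  rcases toFull_eq_inl_or_inner x with ⟨i, hi⟩ | ⟨σ, i, rfl, hi, hi'⟩ <;>
    rcases toFull_eq_inl_or_inner y with ⟨j, hj⟩ | ⟨σ', j, rfl, hj, hj'⟩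
  · have h : (i.val, 0) = (j.val, 0) := (hg (.inl i)).symm.trans
      ((congrArg g hi).symm.trans (hgx.trans ((congrArg g hj).trans (hg (.inl j)))))
    obtain rfl : i = j := Fin.ext (congrArg Prod.fst h)
    exact hi.trans hj.symm
  · have h : (i.val, 0) = sidePos σ'.p.val σ'.r σ'.s j.val := (hg (.inl i)).symm.trans
      ((congrArg g hi).symm.trans (hgx.trans (hg _)))
    rw [sidePos_of_lt hj'] at h
    exact absurd (congrArg Prod.snd h) hj.ne
  · have h : sidePos σ.p.val σ.r σ.s i.val = (j.val, 0) := (hg _).symm.trans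
      (hgx.trans ((congrArg g hj).trans (hg (.inl j))))
    rw [sidePos_of_lt hi'] at h
    exact absurd (congrArg Prod.snd h) hi.ne'
  · have h : sidePos σ.p.val σ.r σ.s i.val = sidePos σ'.p.val σ'.r σ'.s j.val := h
    rw [sidePos_of_lt hi', sidePos_of_lt hj'] at h
    obtain rfl := Site.ext_of_p hR (congrArg Prod.fst h)
    obtain rfl : i = j := Fin.ext (congrArg Prod.snd h)
    rfl

theorem exists_edge_of_modelStep (hR : IsRigid R) {m n : ℕ × ℕ} {a : X}
    (h : ModelStep R t m a n) : ∃ x y, toModel R t x = m ∧ toModel R t y = n ∧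
      (disjointUnion R (linear (pos t))).Edge x (a, true) y := by
  cases h with
  | @base i _ h =>
    have hi := (List.getElem?_eq_some_iff.1 h).1
    have hlen : (pos t).length = t.length := List.length_map _
    exact ⟨.inl ⟨i, by omega⟩, .inl ⟨i + 1, by omega⟩, rfl, rfl,
      linear_pos_edge_true.2 ⟨rfl, h⟩⟩
  | @side i k r s _ h hx =>
    obtain ⟨σ, rfl, rfl, rfl⟩ := h.exists_site hR
    have hi := (List.getElem?_eq_some_iff.1 hx).1
    have hlen : (pos σ.s).length = σ.s.length := List.length_map _
    refine ⟨.inr ⟨σ, ⟨k, by omega⟩⟩, .inr ⟨σ, ⟨k + 1, by omega⟩⟩, sidePos_of_lt hi, rfl,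
      disjointUnion_edge_iff.2 (.inr ⟨σ, _, _, rfl, rfl, linear_pos_edge_true.2 ⟨rfl, hx⟩⟩)⟩

theorem IsRigid.fullExpansion_closed (hR : IsRigid R) {r s : List X}
    (hrs : (r, s) ∈ R ∨ (s, r) ∈ R) {p q : (fullExpansion R (linear (pos t))).V}
    (h : (fullExpansion R (linear (pos t))).Reads p (pos r) q) :
    (fullExpansion R (linear (pos t))).Reads p (pos s) q := by
  obtain ⟨g, hg, hge⟩ := exists_lift_fullExpansion (G := linear (pos t)) (model R t)
    (model_det hR) (toModel R t) (fun _ _ _ => toModel_edge) (fun _ _ => toModel_sew hR)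
  have hinj : Function.Injective g := by
    intro p q h
    obtain ⟨x, rfl⟩ := toFull_surjective p
    obtain ⟨y, rfl⟩ := toFull_surjective q
    rw [hg, hg] at h
    exact toFull_eq_of_toModel_eq hR h
  -- Every positive edge of the model comes from an edge of the expansion, so injectivity lets
  -- positive paths be pulled back edge by edge.
  have hlift (w : List X) (p q) (h : (model R t).Reads (g p) (pos w) (g q)) :
      (fullExpansion R (linear (pos t))).Reads p (pos w) q := by
    induction w generalizing p with
    | nil => exact hinj h
    | cons a w ih =>
      obtain ⟨m, h1, h2⟩ := model_reads_cons.1 h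
      obtain ⟨x, y, hx, rfl, he⟩ := exists_edge_of_modelStep hR h1
      rw [← hg] at hx
      obtain rfl := hinj hx
      rw [← hg] at h2
      exact ⟨_, fullExpansion_edge_iff.2 ⟨x, y, rfl, rfl, he⟩, ih _ h2⟩
  exact hlift s p q (hR.model_closed hrs
    (h.map (G := (fullExpansion R (linear (pos t))).toLGraph) (H := model R t) g hge))

theorem IsRigid.nonempty_iso (hR : IsRigid R) (t : List X) :
    Nonempty (Birooted.Iso (fullExpansion R (linear (pos t)))
      (schutzenbergerAutomaton R (pos t))) := by
  obtain ⟨φ, hφ, hstart⟩ := exists_map_fullExpansion_linear R t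
  exact nonempty_iso_schutzenbergerAutomaton (pos t) _ (fullExpansion_isInverse linear_symm)
    (fun r s h p q => ⟨hR.fullExpansion_closed (.inl h), hR.fullExpansion_closed (.inr h)⟩)
    (fullExpansion_reach fun i => ⟨_, linear_pos_reads_take i⟩)
    (reads_toFull_inl (linear_pos_reads t)) φ hφ hstart

end Closed

/-! ## One-relator Adian presentations -/

section OneRelator

variable {X : Type u}

/-- Equal letters would turn the edge of the relation into a loop, a closed walk of length one. -/
theorem CycleFree.ne_of_letterGraph {f : List X → Option X} {r s : List X} {x y : X}
    (h : CycleFree (letterGraph f {(r, s)})) (hx : f r = some x) (hy : f s = some y) : x ≠ y := by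
  rintro rfl
  have := h x [(r, s)] ⟨x, ⟨rfl, .inl ⟨hx, hy⟩⟩, rfl⟩ (by simp)
  simp at this

theorem isRigid_singleton {u v : List X} (hAdian : IsAdian {(u, v)})
    (huv : ¬ u <:+: v) (hvu : ¬ v <:+: u)
    (hoverlap : ∀ r ∈ ({u, v} : Set (List X)), ∀ s ∈ ({u, v} : Set (List X)), ¬ Overlaps r s) :
    IsRigid {(u, v)} := by
  obtain ⟨hu, hv⟩ := hAdian.positive (u, v) rfl
  have hhead : u.head? ≠ v.head? := by
    intro h
    have h1 := List.head?_eq_some_head hu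
    exact hAdian.left_cycleFree.ne_of_letterGraph h1 (h ▸ h1) rfl
  have hlast : u.getLast? ≠ v.getLast? := by
    intro h
    have h1 := List.getLast?_eq_some_getLast hu
    exact hAdian.right_cycleFree.ne_of_letterGraph h1 (h ▸ h1) rfl
  have hmem {r s : List X} (h : (r, s) ∈ ({(u, v)} : Set (List X × List X)) ∨
      (s, r) ∈ ({(u, v)} : Set (List X × List X))) : (r = u ∧ s = v) ∨ (r = v ∧ s = u) := by
    simpa [and_comm] using h
  constructor
  · intro r s h
    rcases hmem h with ⟨rfl, rfl⟩ | ⟨rfl, rfl⟩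
    exacts [hhead, hhead.symm]
  · intro r s h
    rcases hmem h with ⟨rfl, rfl⟩ | ⟨rfl, rfl⟩
    exacts [hlast, hlast.symm]
  · intro r s h
    rcases hmem h with ⟨rfl, rfl⟩ | ⟨rfl, rfl⟩
    exacts [hv, hu]
  · intro r s r' s' h h' hi
    rcases hmem h with ⟨rfl, rfl⟩ | ⟨rfl, rfl⟩ <;> rcases hmem h' with ⟨rfl, rfl⟩ | ⟨rfl, rfl⟩
    exacts [⟨rfl, rfl⟩, (huv hi).elim, (hvu hi).elim, ⟨rfl, rfl⟩]
  · intro r s r' s' h h'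
    refine hoverlap r ?_ r' ?_
    · rcases hmem h with ⟨rfl, -⟩ | ⟨rfl, -⟩ <;> simp
    · rcases hmem h' with ⟨rfl, -⟩ | ⟨rfl, -⟩ <;> simp

end OneRelator

end AdianInv

theorem lemmaL2 {X : Type*} (u v : List X)
    (hAdian : AdianInv.IsAdian {(u, v)})
    (huv : ¬ u <:+: v) (hvu : ¬ v <:+: u)
    (hoverlap : ∀ r ∈ ({u, v} : Set (List X)), ∀ s ∈ ({u, v} : Set (List X)),
      ¬ AdianInv.Overlaps r s)
    (t : List X) (ht : t ≠ []) :
    (AdianInv.schutzenbergerGraph {(u, v)} (AdianInv.pos t)).IsFinite ∧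
      Nonempty (AdianInv.Birooted.Iso
        (AdianInv.fullExpansion {(u, v)} (AdianInv.linear (AdianInv.pos t)))
        (AdianInv.schutzenbergerAutomaton {(u, v)} (AdianInv.pos t))) := by
  have hR := AdianInv.isRigid_singleton hAdian huv hvu hoverlap
  obtain ⟨e⟩ := hR.nonempty_iso t
  refine ⟨e.isFinite ?_, ⟨e⟩⟩
  have : Finite (AdianInv.linear (AdianInv.pos t)).V := inferInstanceAs (Finite (Fin _))
  exact AdianInv.fullExpansion_isFinite (Set.finite_singleton _) (List.finite_toSet t)
    fun _ _ _ h => AdianInv.linear_pos_edge_mem h
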